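/- Write $\mathcal J_k=\begin{bmatrix}0&I_k\\-I_k&0\end{bmatrix}$, $\mathcal J=\mathcal J_n$. A matrix $H\in\mathbb C^{2n\times 2n}$ is Hamiltonian if $H\mathcal J=(H\mathcal J)^H$, and $S$ is symplectic if $S\mathcal JS^H=\mathcal J$. For symplectic $\mathcal S_1,\mathcal S_2$ and a Hermitian $X=[X_{ij}]_{1\le i,j\le2}\in\mathbb C^{2n\times2n}$ (with $n\times n$ blocks) put $$T_{\mathcal S_1,\mathcal S_2}(X)=\left(\begin{bmatrix}X_{12}&0\\X_{22}&I\end{bmatrix}\mathcal S_2,\ \begin{bmatrix}I&X_{11}\\0&X_{21}\end{bmatrix}\mathcal S_1\right),$$ a bijection from the Hermitian matrices onto its image $\mathbb S_{\mathcal S_1,\mathcal S_2}$. A pair $(A,B)$ is regular if $\det(A-\lambda B)\ne0$ for some $\lambda\in\mathbb C$; then $PAQ=K\oplus I$, $PBQ=I\oplus N$ with $P,Q$ invertible and $N$ nilpotent, and $\mathrm{ind}_\infty(A,B)$ is the index of nilpotency of $N$ ($0$ if $N$ is empty). **Theorem.** Let $\mathcal S_1,\mathcal S_2\in\mathbb C^{2n\times2n}$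 be symplectic and let $X_1=[X^1_{ij}]$ be Hermitian such that $(\mathcal M_1,\mathcal L_1)=T_{\mathcal S_1,\mathcal S_2}(X_1)$ is regular with $\mathrm{ind}_\infty(\mathcal M_1,\mathcal L_1)\le1$. Let $\hat n+\ell=n$, let $\mathbf U=[U_1|U_0,U_\infty]$ with $U_1\in\mathbb C^{2n\times2\hat n}$, $U_0,U_\infty\in\mathbb C^{2n\times\ell}$, let $\widehat{\mathcal S}\in\mathbb C^{2\hat n\times2\hat n}$ be symplectic and $\widehat{\mathcal H}$ Hamiltonian with $$\mathbf U^H\mathcal J\mathbf U=\mathcal J_{\hat n}\oplus\mathcal J_\ell,\quad \mathcal M_1U_0=0,\quad \mathcal L_1U_\infty=0,\quad \mathcal M_1U_1=\mathcal L_1U_1\widehat{\mathcal S},\quad e^{\widehat{\mathcal H}}=\widehat{\mathcal S}.$$ With $\mathbf V=(\mathcal J_{\hat n}\oplus\mathcal J_\ell)^H\mathbf U^H\mathcal J=\mathbf U^{-1}$ put $\mathcal H=\mathbf U(\widehat{\mathcal H}\oplus0\oplus 0)\mathbf V$, $\Pi_0=\mathbf U(I_{2\hat n}\oplus I_\ell\oplus0)\mathbf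 V$, $\Pi_\infty=\mathbf U(I_{2\hat n}\oplus0\oplus I_\ell)\mathbf V$. For $t\in\mathbb R$ consider the linear system with unknown $(\mathcal M(t),\mathcal L(t))$ $$(\ast)\qquad \mathcal M(t)\Pi_0=\mathcal L(t)\Pi_\infty e^{\mathcal Ht},\qquad(\mathcal M(t),\mathcal L(t))\in\mathbb S_{\mathcal S_1,\mathcal S_2},$$ and let $\mathcal T_X=\{t\in\mathbb R:(\ast)\text{ has a solution at }t\}$. Write $\mathcal S_2\mathcal H\mathcal S_2^{-1}=\begin{bmatrix}A&S\\D&-A^H\end{bmatrix}$ and $\mathcal S_1\mathcal H\mathcal S_1^{-1}=\begin{bmatrix}A_\star&S_\star\\D_\star&-A_\star^H\end{bmatrix}$, and let $(Q,P)$, $(Q_\star,P_\star)$ be the solutions on $\mathbb R$ of $$\frac{d}{dt}\begin{bmatrix}Q\\P\end{bmatrix}=\begin{bmatrix}-A&S\\D&A^H\end{bmatrix}\begin{bmatrix}Q\\P\end{bmatrix},\ \begin{bmatrix}Q(0)\\P(0)\end{bmatrix}=\begin{bmatrix}I\\X^1_{22}\end{bmatrix},\qquad \frac{d}{dt}\begin{bmatrix}Q_\star\\P_\star\end{bmatrix}=\begin{bmatrix}-A_\star^H&-D_\star\\-S_\star&A_\star\end{bmatrix}\begin{bmatrix}Q_\star\\P_\star\end{bmatrix},\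 \begin{bmatrix}Q_\star(0)\\P_\star(0)\end{bmatrix}=\begin{bmatrix}I\\X^1_{11}\end{bmatrix}.$$ Let $\mathcal T_W+1=\{t\in\mathbb R:Q(t-1)\text{ is invertible}\}$. Then $Q_\star(t-1)$ is invertible for every $t\in\mathcal T_W+1$, so that the *extended solution* $$X_{11}(t)=P_\star(t-1)Q_\star(t-1)^{-1},\quad X_{12}(t)=X^1_{12}Q(t-1)^{-1},\quad X_{21}(t)=X^1_{21}Q_\star(t-1)^{-1},\quad X_{22}(t)=P(t-1)Q(t-1)^{-1}$$ is defined for all $t\in\mathcal T_W+1$. Moreover $1\in\mathcal T_W+1$, $X(1)=X_1$, and $\dot X(t)=\mathcal M(t)\mathcal H\mathcal J\mathcal M(t)^H$ for all $t\in\mathcal T_W+1$, where $(\mathcal M(t),\mathcal L(t))=T_{\mathcal S_1,\mathcal S_2}(X(t))$. Furthermore: (i) for every $t\in\mathcal T_W+1$ the matrix $X(t)$ is Hermitian and $T_{\mathcal S_1,\mathcal S_2}(X(t))$ satisfies $(\ast)$ at $t$; (ii) $\mathcal T_W+1=\mathcal T_X$; (iii) if $(\mathcal M(t),\mathcal L(t))$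 solves $(\ast)$ for every $t\in\mathcal T_X$, then $T_{\mathcal S_1,\mathcal S_2}^{-1}(\mathcal M(t),\mathcal L(t))=X(t)$ for every $t\in\mathcal T_X$, i.e. $(\mathcal M(t),\mathcal L(t))=T_{\mathcal S_1,\mathcal S_2}(X(t))$ with $X$ the extended solution. -/

import Mathlib

open scoped Matrix

namespace SymplecticFlow

noncomputable section

/-- Complex `2n × 2n` matrices, viewed as `2 × 2` block matrices with `n × n` blocks. -/
abbrev Mat2 (n : ℕ) : Type := Matrix (Fin n ⊕ Fin n) (Fin n ⊕ Fin n) ℂ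

/-- The matrix `𝒥ₙ = [[0, I], [-I, 0]]`. -/
def J (n : ℕ) : Mat2 n := Matrix.fromBlocks 0 1 (-1) 0

/-- `H` is Hamiltonian: `H 𝒥 = (H 𝒥)ᴴ`. -/
def IsHamiltonian {n : ℕ} (H : Mat2 n) : Prop := H * J n = (H * J n)ᴴ

/-- `S` is symplectic (with respect to the conjugate transpose): `S 𝒥 Sᴴ = 𝒥`. -/
def IsSymplectic {n : ℕ} (S : Mat2 n) : Prop := S * J n * Sᴴ = J n

/-- The matrix pair `(A, B)` is regular: `det (A - λ B) ≠ 0` for some `λ`. -/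
def IsRegularPair {ι : Type*} [Fintype ι] [DecidableEq ι] (A B : Matrix ι ι ℂ) : Prop :=
  ∃ z : ℂ, (A - z • B).det ≠ 0

/-- `ind_∞ (A, B) = ν`: there are invertible `P`, `Q` with `P A Q = K ⊕ I` and `P B Q = I ⊕ N`,
where `N` is nilpotent of index of nilpotency exactly `ν`. Bringing `K` and `N` to Jordan form
does not change the index of nilpotency. The block `N` is empty (and then `ν = 0`) exactly when
`B` is invertible. -/
def HasIndexAtInfinity {ι : Type*} [Fintype ι] [DecidableEq ι]
    (A B : Matrix ι ι ℂ) (ν : ℕ) : Prop :=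
  ∃ (p q : ℕ) (e : ι ≃ Fin p ⊕ Fin q) (P Q : Matrix ι ι ℂ)
    (K : Matrix (Fin p) (Fin p) ℂ) (N : Matrix (Fin q) (Fin q) ℂ),
    IsUnit P ∧ IsUnit Q ∧
    P * A * Q = (Matrix.fromBlocks K 0 0 1).submatrix e e ∧
    P * B * Q = (Matrix.fromBlocks 1 0 0 N).submatrix e e ∧
    N ^ ν = 0 ∧ ∀ k < ν, N ^ k ≠ 0

/-- The transformation
`T_{S₁,S₂}(X) = ([[X₁₂, 0], [X₂₂, I]] S₂, [[I, X₁₁], [0, X₂₁]] S₁)`. -/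
def T {n : ℕ} (S₁ S₂ X : Mat2 n) : Mat2 n × Mat2 n :=
  (Matrix.fromBlocks X.toBlocks₁₂ 0 X.toBlocks₂₂ 1 * S₂,
   Matrix.fromBlocks 1 X.toBlocks₁₁ 0 X.toBlocks₂₁ * S₁)

/-- The class `𝕊_{S₁,S₂}`: the image of the Hermitian matrices under `T_{S₁,S₂}`. -/
def pairClass {n : ℕ} (S₁ S₂ : Mat2 n) : Set (Mat2 n × Mat2 n) :=
  T S₁ S₂ '' {X | X.IsHermitian}

/-- The inverse of the bijection `T_{S₁,S₂}` from the Hermitian matrices onto `𝕊_{S₁,S₂}`. -/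
def Tinv {n : ℕ} (S₁ S₂ : Mat2 n) : Mat2 n × Mat2 n → Mat2 n :=
  Function.invFunOn (T S₁ S₂) {X | X.IsHermitian}

/-- The objects `n̂`, `ℓ`, `𝐔 = [U₁ | U₀, U_∞]`, `Ŝ`, `Ĥ` attached to a pair `(M, L)`.
(For a regular pair, `rank M = rank L = n + n̂` is a consequence.) -/
structure SpectralData {n : ℕ} (M L : Mat2 n) where
  nhat : ℕ
  l : ℕ
  dim : nhat + l = n
  U₁ : Matrix (Fin n ⊕ Fin n) (Fin nhat ⊕ Fin nhat) ℂ
  U₀ : Matrix (Fin n ⊕ Fin n) (Fin l) ℂ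
  Uinf : Matrix (Fin n ⊕ Fin n) (Fin l) ℂ
  Shat : Mat2 nhat
  Hhat : Mat2 nhat
  /-- `𝐔ᴴ 𝒥ₙ 𝐔 = 𝒥_n̂ ⊕ 𝒥_ℓ` -/
  gram : (Matrix.fromCols U₁ (Matrix.fromCols U₀ Uinf))ᴴ * J n *
      Matrix.fromCols U₁ (Matrix.fromCols U₀ Uinf) = Matrix.fromBlocks (J nhat) 0 0 (J l)
  zero_eq : M * U₀ = 0
  inf_eq : L * Uinf = 0
  fin_eq : M * U₁ = L * U₁ * Shat
  symp : IsSymplectic Shat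
  ham : IsHamiltonian Hhat
  exp_eq : NormedSpace.exp Hhat = Shat

namespace SpectralData

variable {n : ℕ} {M L : Mat2 n} (d : SpectralData M L)

/-- `𝐔 = [U₁ | U₀, U_∞]`. -/
def U : Matrix (Fin n ⊕ Fin n) ((Fin d.nhat ⊕ Fin d.nhat) ⊕ (Fin d.l ⊕ Fin d.l)) ℂ :=
  Matrix.fromCols d.U₁ (Matrix.fromCols d.U₀ d.Uinf)

/-- `(𝒥_n̂ ⊕ 𝒥_ℓ)ᴴ 𝐔ᴴ 𝒥ₙ`, which is the inverse of `𝐔`. -/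
def V : Matrix ((Fin d.nhat ⊕ Fin d.nhat) ⊕ (Fin d.l ⊕ Fin d.l)) (Fin n ⊕ Fin n) ℂ :=
  (Matrix.fromBlocks (J d.nhat) 0 0 (J d.l))ᴴ * (d.U)ᴴ * J n

/-- `𝐔 (A ⊕ B) (𝒥_n̂ ⊕ 𝒥_ℓ)ᴴ 𝐔ᴴ 𝒥`, for `A` of size `2n̂` and `B` of size `2ℓ`. -/
def conj (A : Mat2 d.nhat) (B : Mat2 d.l) : Mat2 n :=
  d.U * Matrix.fromBlocks A 0 0 B * d.V

/-- `H = 𝐔 (Ĥ ⊕ 0) (𝒥_n̂ ⊕ 𝒥_ℓ)ᴴ 𝐔ᴴ 𝒥`. -/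
def H : Mat2 n := d.conj d.Hhat 0

/-- `Π₀ = 𝐔 (I ⊕ I ⊕ 0) (𝒥_n̂ ⊕ 𝒥_ℓ)ᴴ 𝐔ᴴ 𝒥`. -/
def Pi₀ : Mat2 n := d.conj 1 (Matrix.fromBlocks 1 0 0 0)

/-- `Π_∞ = 𝐔 (I ⊕ 0 ⊕ I) (𝒥_n̂ ⊕ 𝒥_ℓ)ᴴ 𝐔ᴴ 𝒥`. -/
def Piinf : Mat2 n := d.conj 1 (Matrix.fromBlocks 0 0 0 1)

end SpectralData

/-- The linear system at time `t`, with unknown pair `p = (M(t), L(t))`: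
`M(t) Π₀ = L(t) Π_∞ e^{Ht}` and `(M(t), L(t)) ∈ 𝕊_{S₁,S₂}` (with `E₀ = Π₀`, `Einf = Π_∞`). -/
def SolvesLinearSystem {n : ℕ} (S₁ S₂ E₀ Einf H : Mat2 n) (t : ℝ) (p : Mat2 n × Mat2 n) :
    Prop :=
  p.1 * E₀ = p.2 * Einf * NormedSpace.exp (t • H) ∧ p ∈ pairClass S₁ S₂

/-- `𝒯_X`: the times at which the linear system has a solution. -/
def TX {n : ℕ} (S₁ S₂ E₀ Einf H : Mat2 n) : Set ℝ :=
  {t | ∃ p, SolvesLinearSystem S₁ S₂ E₀ Einf H t p}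

/-- For `S₂ H S₂⁻¹ = [[A, S], [D, -Aᴴ]]`, the matrix `H̃ = [[-A, S], [D, Aᴴ]]`. -/
def Htilde {n : ℕ} (S₂ H : Mat2 n) : Mat2 n :=
  Matrix.fromBlocks (-(S₂ * H * S₂⁻¹).toBlocks₁₁) (S₂ * H * S₂⁻¹).toBlocks₁₂
    (S₂ * H * S₂⁻¹).toBlocks₂₁ ((S₂ * H * S₂⁻¹).toBlocks₁₁)ᴴ

/-- For `S₁ H S₁⁻¹ = [[A⋆, S⋆], [D⋆, -A⋆ᴴ]]`, the matrix `H̃⋆ = [[-A⋆ᴴ, -D⋆], [-S⋆, A⋆]]`. -/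
def HtildeStar {n : ℕ} (S₁ H : Mat2 n) : Mat2 n :=
  Matrix.fromBlocks (-((S₁ * H * S₁⁻¹).toBlocks₁₁)ᴴ) (-(S₁ * H * S₁⁻¹).toBlocks₂₁)
    (-(S₁ * H * S₁⁻¹).toBlocks₁₂) (S₁ * H * S₁⁻¹).toBlocks₁₁

/-- `Y = [Q; P] : ℝ → ℂ^{2n × n}` is the solution on `ℝ` of the linear initial value problem
`Y' = G Y`, `Y(0) = [I; W₀]`. -/
def IsLinearFlow {n : ℕ} (G : Mat2 n) (W₀ : Matrix (Fin n) (Fin n) ℂ)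
    (Q P : ℝ → Matrix (Fin n) (Fin n) ℂ) : Prop :=
  (∀ t : ℝ, HasDerivAt (fun s => Matrix.fromRows (Q s) (P s))
    (G * Matrix.fromRows (Q t) (P t)) t) ∧ Q 0 = 1 ∧ P 0 = W₀

/-- `𝒯_W + 1 = {t | Q(t - 1) is invertible}`. -/
def TWplusOne {n : ℕ} (Q : ℝ → Matrix (Fin n) (Fin n) ℂ) : Set ℝ :=
  {t | IsUnit (Q (t - 1))}

/-- The extended solution, with blocks
`X₁₁(t) = P⋆(t-1) Q⋆(t-1)⁻¹`, `X₁₂(t) = X₁₂¹ Q(t-1)⁻¹`,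
`X₂₁(t) = X₂₁¹ Q⋆(t-1)⁻¹`, `X₂₂(t) = P(t-1) Q(t-1)⁻¹`. -/
def extendedSolution {n : ℕ} (X₁ : Mat2 n) (Q P Qs Ps : ℝ → Matrix (Fin n) (Fin n) ℂ)
    (t : ℝ) : Mat2 n :=
  Matrix.fromBlocks
    (Ps (t - 1) * (Qs (t - 1))⁻¹) (X₁.toBlocks₁₂ * (Q (t - 1))⁻¹)
    (X₁.toBlocks₂₁ * (Qs (t - 1))⁻¹) (P (t - 1) * (Q (t - 1))⁻¹)

end

end SymplecticFlow

/-!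
The linear system says that the rows of `[M, -L]` annihilate the columns of `[Π₀; Π_∞ e^{Ht}]`.
Since `H` commutes with `Π₀` and `Π_∞`, these columns move with `t` by the flow of `H` alone, so the
annihilator at time `t` is spanned by the rows of the initial pair, moved by the flow: of
`(M₁ e^{(t-1)H}, L₁)`, or equally of `(M₁, L₁ e^{-(t-1)H})` (`shifted_system`). A solution at time
`t` is thus the same as a matrix `F` that brings the moved pair to the normal form `T(X)`, and `X` is
then automatically Hermitian, because Hermitian `X` are characterized by
`M 𝒥 Mᴴ = L 𝒥 Lᴴ` (`isHermitian_iff_T`), a relation preserved by the symplectic flow and by `F`.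

For the first of the two moved pairs the pivot block that has to be inverted is `Q(t-1)ᴴ`
(`flow_Htilde`), and the lower blocks of `X` come out as the conjugate transposes of the second block
column of the extended solution (`exists_solution_of_isUnit`). For the other pair the pivot is
`Q⋆(t-1)ᴴ` (`flow_HtildeStar`), and the upper blocks of `X` give the first block column
(`exists_solution_of_isUnit_star`). Conversely, if the system is solvable at `t`, its homogeneous
version has only the zero solution (`eq_zero_of_solvable`). This gives uniqueness, and it makes both
pivots invertible (`isUnit_of_solvable`, `isUnit_of_solvable_star`). Hence both normalizations are
available at the same times, which are the times of solvability, and they yield the same matrix.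

The differential equation follows by the quotient rule. The columns built from `[Q; P]` match
`M H 𝒥 Mᴴ` and those built from `[Q⋆; P⋆]` match `L H 𝒥 Lᴴ`; the two velocities agree along
solutions (`velocity_eq`).
-/

namespace SymplecticFlow

/-! ### Calculus of matrix-valued functions -/

/-- Differentiation is entrywise. Matrices carry no global norm, so the statement concerns the
product topology; the sup norm used in the proof induces it. -/
theorem hasDerivAt_matrix_iff {ι κ : Type*} [Fintype ι] [Fintype κ]
    {f : ℝ → Matrix ι κ ℂ} {f' : Matrix ι κ ℂ} {t : ℝ} :
    HasDerivAt f f' t ↔ ∀ i j, HasDerivAt (fun s => f s i j) (f' i j) t := by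
  let _ := Matrix.normedAddCommGroup (m := ι) (n := κ) (α := ℂ)
  let _ := Matrix.normedSpace (m := ι) (n := κ) (α := ℂ) (R := ℝ)
  have h1 := hasDerivAt_pi (𝕜 := ℝ) (x := t) (φ := f) (φ' := f')
  simp_rw [hasDerivAt_pi] at h1
  exact h1

theorem hasDerivAt_matrix_mul {ι κ ρ : Type*} [Fintype ι] [Fintype κ] [Fintype ρ]
    {f : ℝ → Matrix ι κ ℂ} {f' : Matrix ι κ ℂ} {g : ℝ → Matrix κ ρ ℂ} {g' : Matrix κ ρ ℂ} {t : ℝ}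
    (hf : HasDerivAt f f' t) (hg : HasDerivAt g g' t) :
    HasDerivAt (fun s => f s * g s) (f' * g t + f t * g') t := by
  rw [hasDerivAt_matrix_iff] at *
  intro i j
  simp only [Matrix.mul_apply, Matrix.add_apply, ← Finset.sum_add_distrib]
  exact HasDerivAt.fun_sum fun k _ => (hf i k).mul (hg k j)

theorem hasDerivAt_matrix_const_mul {ι κ ρ : Type*} [Fintype ι] [Fintype κ] [Fintype ρ]
    (A : Matrix ι κ ℂ) {g : ℝ → Matrix κ ρ ℂ} {g' : Matrix κ ρ ℂ} {t : ℝ}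
    (hg : HasDerivAt g g' t) : HasDerivAt (fun s => A * g s) (A * g') t := by
  have hA : HasDerivAt (fun _ : ℝ => A) 0 t :=
    hasDerivAt_matrix_iff.2 fun i j => hasDerivAt_const t (A i j)
  simpa using hasDerivAt_matrix_mul hA hg

theorem hasDerivAt_matrix_inv {ι : Type*} [Fintype ι] [DecidableEq ι]
    {f : ℝ → Matrix ι ι ℂ} {f' : Matrix ι ι ℂ} {t : ℝ}
    (hf : HasDerivAt f f' t) (hu : IsUnit (f t)) :
    HasDerivAt (fun s => (f s)⁻¹) (-((f t)⁻¹ * f' * (f t)⁻¹)) t := by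
  -- Any submultiplicative norm inducing the product topology makes matrices a Banach algebra.
  let _ := Matrix.linftyOpNormedRing (n := ι) (α := ℂ)
  let _ := Matrix.linftyOpNormedAlgebra (n := ι) (R := ℝ) (α := ℂ)
  obtain ⟨u, hu⟩ := hu
  have h := hasFDerivAt_ringInverse (𝕜 := ℝ) u
  rw [hu] at h
  have h2 := h.comp_hasDerivAt t hf
  have e : ((↑u⁻¹ : Matrix ι ι ℂ)) = (f t)⁻¹ := by rw [← hu, Matrix.coe_units_inv]
  have e2 : (fun s => (f s)⁻¹) = Ring.inverse ∘ f := by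
    funext s; simp [Matrix.nonsing_inv_eq_ringInverse]
  rw [e2]
  refine h2.congr_deriv ?_
  simp [e]

theorem hasDerivAt_matrix_exp_smul {ι : Type*} [Fintype ι] [DecidableEq ι]
    (A : Matrix ι ι ℂ) (t : ℝ) :
    HasDerivAt (fun s : ℝ => NormedSpace.exp (s • A)) (NormedSpace.exp (t • A) * A) t := by
  let _ := Matrix.linftyOpNormedRing (n := ι) (α := ℂ)
  let _ := Matrix.linftyOpNormedAlgebra (n := ι) (R := ℝ) (α := ℂ)
  exact hasDerivAt_exp_smul_const A t

theorem matrix_exp_smul_commute {ι : Type*} [Fintype ι] [DecidableEq ι]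
    (A B : Matrix ι ι ℂ) (h : A * B = B * A) (t : ℝ) :
    NormedSpace.exp (t • A) * B = B * NormedSpace.exp (t • A) := by
  let _ := Matrix.linftyOpNormedRing (n := ι) (α := ℂ)
  let _ := Matrix.linftyOpNormedAlgebra (n := ι) (R := ℝ) (α := ℂ)
  have h0 : Commute A B := h
  exact ((h0.smul_left t).exp_left).eq

/-- Uniqueness for the linear equation `Y' = G Y`: the product `exp(-tG) Y(t)` is constant. -/
theorem eq_exp_smul_mul {ι κ : Type*} [Fintype ι] [DecidableEq ι] [Fintype κ]
    (G : Matrix ι ι ℂ) (Y : ℝ → Matrix ι κ ℂ)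
    (hY : ∀ t, HasDerivAt Y (G * Y t) t) (t : ℝ) :
    Y t = NormedSpace.exp (t • G) * Y 0 := by
  have key : ∀ s, HasDerivAt (fun s : ℝ => NormedSpace.exp (s • (-G)) * Y s) 0 s := by
    intro s
    convert hasDerivAt_matrix_mul (hasDerivAt_matrix_exp_smul (-G) s) (hY s) using 1
    simp [Matrix.mul_assoc]
  have hconst : NormedSpace.exp (t • (-G)) * Y t = Y 0 := by
    ext i j
    have h1 : ∀ s, HasDerivAt (fun s : ℝ => (NormedSpace.exp (s • (-G)) * Y s) i j) 0 s :=
      fun s => hasDerivAt_matrix_iff.1 (key s) i j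
    have := is_const_of_deriv_eq_zero (fun s => (h1 s).differentiableAt) (fun s => (h1 s).deriv) t 0
    simpa using this
  rw [← hconst, ← Matrix.mul_assoc, smul_neg, Matrix.exp_neg, Matrix.mul_nonsing_inv,
    Matrix.one_mul]
  exact (Matrix.isUnit_iff_isUnit_det _).1 (Matrix.isUnit_exp _)

/-- An intertwining relation `A C = C B` passes to the exponentials, also for rectangular `C`: both
sides solve `Y' = A Y` with the same initial value. -/
theorem exp_smul_mul_of_intertwine {ι κ : Type*} [Fintype ι] [DecidableEq ι] [Fintype κ]
    [DecidableEq κ] {A : Matrix ι ι ℂ} {B : Matrix κ κ ℂ} {C : Matrix ι κ ℂ}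
    (h : A * C = C * B) (t : ℝ) :
    NormedSpace.exp (t • A) * C = C * NormedSpace.exp (t • B) := by
  have := eq_exp_smul_mul A (fun s : ℝ => C * NormedSpace.exp (s • B)) (fun s => by
    convert hasDerivAt_matrix_const_mul C (hasDerivAt_matrix_exp_smul B s) using 1
    rw [← Matrix.mul_assoc A, h, Matrix.mul_assoc, matrix_exp_smul_commute B B rfl]) t
  simpa using this.symm

variable {n : ℕ}

/-- Complex `n × n` matrices, the blocks of `Mat2 n`. -/
abbrev Mat1 (n : ℕ) : Type := Matrix (Fin n) (Fin n) ℂ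

/-! ### Symplectic and Hamiltonian matrices, and the pair `T(X)` -/

theorem J_conjTranspose (n : ℕ) : (J n)ᴴ = -J n := by
  simp [J, Matrix.fromBlocks_conjTranspose, Matrix.fromBlocks_neg]

theorem J_mul_J (n : ℕ) : J n * J n = -1 := by
  simp [J, Matrix.fromBlocks_multiply, ← Matrix.fromBlocks_one, Matrix.fromBlocks_neg]

theorem IsSymplectic.isUnit {S : Mat2 n} (h : IsSymplectic S) : IsUnit S := by
  have h1 : S * (J n * Sᴴ * -J n) = 1 := by
    rw [← Matrix.mul_assoc, ← Matrix.mul_assoc, h, Matrix.mul_neg, J_mul_J, neg_neg]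
  exact IsUnit.of_mul_eq_one _ h1

theorem IsSymplectic.inv_mul {S : Mat2 n} (h : IsSymplectic S) : S⁻¹ * S = 1 :=
  Matrix.nonsing_inv_mul _ ((Matrix.isUnit_iff_isUnit_det _).1 h.isUnit)

theorem IsSymplectic.inv_mul_J {S : Mat2 n} (h : IsSymplectic S) :
    S⁻¹ * J n = J n * Sᴴ := by
  conv_lhs => rw [← show S * J n * Sᴴ = J n from h]
  rw [Matrix.mul_assoc, ← Matrix.mul_assoc, h.inv_mul, Matrix.one_mul]

theorem isHamiltonian_iff {H : Mat2 n} : IsHamiltonian H ↔ H * J n = -(J n * Hᴴ) := by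
  rw [IsHamiltonian, Matrix.conjTranspose_mul, J_conjTranspose, Matrix.neg_mul]

theorem IsHamiltonian.conj {S H : Mat2 n} (hS : IsSymplectic S) (hH : IsHamiltonian H) :
    IsHamiltonian (S * H * S⁻¹) := by
  have : S * H * S⁻¹ * J n = S * (H * J n) * Sᴴ := by
    rw [Matrix.mul_assoc _ _ (J n), hS.inv_mul_J]; simp only [Matrix.mul_assoc]
  rw [IsHamiltonian, this, Matrix.conjTranspose_mul, Matrix.conjTranspose_mul, ← hH,
    Matrix.conjTranspose_conjTranspose, Matrix.mul_assoc]

/-- The flow of a Hamiltonian matrix is symplectic. -/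
theorem IsHamiltonian.isSymplectic_exp {H : Mat2 n} (hH : IsHamiltonian H) (t : ℝ) :
    IsSymplectic (NormedSpace.exp (t • H)) := by
  have h1 : (-Hᴴ) * J n = J n * H := by
    have := isHamiltonian_iff.1 hH
    have h2 : J n * (H * J n) * J n = J n * -(J n * Hᴴ) * J n := by rw [this]
    simp only [Matrix.mul_assoc, J_mul_J, Matrix.mul_neg, Matrix.mul_one] at h2
    simp only [← Matrix.mul_assoc, J_mul_J, Matrix.neg_mul, Matrix.one_mul, neg_neg] at h2
    rw [Matrix.neg_mul, ← h2, neg_neg]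
  have h2 : H * J n = J n * (-Hᴴ) := by rw [isHamiltonian_iff.1 hH, Matrix.mul_neg]
  rw [IsSymplectic, exp_smul_mul_of_intertwine h2, ← Matrix.exp_conjTranspose, smul_neg,
    Matrix.exp_neg, Matrix.mul_assoc, Matrix.conjTranspose_smul, star_trivial,
    Matrix.nonsing_inv_mul, Matrix.mul_one]
  exact (Matrix.isUnit_iff_isUnit_det _).1 (Matrix.isUnit_exp _)

theorem IsHamiltonian.blocks {G : Mat2 n} (h : IsHamiltonian G) :
    G.toBlocks₂₂ = -(G.toBlocks₁₁)ᴴ ∧ (G.toBlocks₁₂)ᴴ = G.toBlocks₁₂ ∧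
      (G.toBlocks₂₁)ᴴ = G.toBlocks₂₁ := by
  rw [IsHamiltonian, ← Matrix.fromBlocks_toBlocks G, J] at h
  simp only [Matrix.fromBlocks_multiply, Matrix.fromBlocks_conjTranspose,
    Matrix.fromBlocks_inj] at h
  obtain ⟨h1, h2, h3, h4⟩ := h
  simp at h1 h2 h3 h4
  refine ⟨?_, h1.symm, h4.symm⟩
  rw [h2]; simp

theorem T_injective {S₁ S₂ : Mat2 n} (hS₁ : IsSymplectic S₁) (hS₂ : IsSymplectic S₂) :
    Function.Injective (T S₁ S₂) := by
  intro X X' h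
  have c : ∀ {S A B : Mat2 n}, IsSymplectic S → A * S = B * S → A = B := fun hS e =>
    hS.isUnit.mul_left_injective e
  simp only [T, Prod.mk.injEq] at h
  have h1 := Matrix.fromBlocks_inj.1 (c hS₂ h.1)
  have h2 := Matrix.fromBlocks_inj.1 (c hS₁ h.2)
  exact Matrix.ext_iff_blocks.2 ⟨h2.2.1, h1.1, h2.2.2.2, h1.2.2.1⟩

/-- `X` is Hermitian exactly when the rows of `[M, L]`, where `(M, L) = T(X)`, are isotropic for
`𝒥 ⊕ (-𝒥)`. This form of the condition survives left multiplication of the pair `(M, L)`. -/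
theorem isHermitian_iff_T {S₁ S₂ : Mat2 n} (hS₁ : IsSymplectic S₁) (hS₂ : IsSymplectic S₂)
    (X : Mat2 n) :
    X.IsHermitian ↔ (T S₁ S₂ X).1 * J n * ((T S₁ S₂ X).1)ᴴ =
      (T S₁ S₂ X).2 * J n * ((T S₁ S₂ X).2)ᴴ := by
  have e : ∀ A S : Mat2 n, IsSymplectic S → (A * S) * J n * (A * S)ᴴ = A * J n * Aᴴ := by
    intro A S hS
    rw [Matrix.conjTranspose_mul]
    calc A * S * J n * (Sᴴ * Aᴴ) = A * (S * J n * Sᴴ) * Aᴴ := by simp only [Matrix.mul_assoc]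
      _ = _ := by rw [show S * J n * Sᴴ = J n from hS]
  simp only [T]
  rw [e _ _ hS₂, e _ _ hS₁]
  conv_lhs => rw [← Matrix.fromBlocks_toBlocks X, Matrix.isHermitian_fromBlocks_iff]
  simp only [J, Matrix.fromBlocks_multiply, Matrix.fromBlocks_conjTranspose,
    Matrix.fromBlocks_inj]
  simp only [Matrix.IsHermitian, Matrix.zero_mul, Matrix.mul_zero, Matrix.mul_one, Matrix.one_mul,
    Matrix.conjTranspose_zero, Matrix.conjTranspose_one, zero_add, add_zero, Matrix.mul_neg,
    Matrix.neg_mul, neg_zero, neg_inj]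
  constructor
  · rintro ⟨h1, h2, h3, h4⟩
    refine ⟨?_, h3.symm, h2, ?_⟩
    · rw [h1]; simp
    · rw [h4]; simp
  · rintro ⟨h1, h2, h3, h4⟩
    refine ⟨?_, h3, h2.symm, ?_⟩
    · rw [← sub_eq_zero, h1]; abel
    · exact neg_add_eq_zero.1 h4

/-! ### The spectral data of the initial pair -/

namespace SpectralData

variable {M L : Mat2 n} (d : SpectralData M L)

theorem V_mul_U : d.V * d.U = 1 := by
  have hJ : ∀ k, (J k)ᴴ * J k = 1 := fun k => by
    rw [J_conjTranspose, Matrix.neg_mul, J_mul_J, neg_neg]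
  rw [V, Matrix.mul_assoc, Matrix.mul_assoc, ← Matrix.mul_assoc _ (J n), U, d.gram]
  simp [Matrix.fromBlocks_conjTranspose, Matrix.fromBlocks_multiply, hJ]

theorem U_mul_V : d.U * d.V = 1 := by
  refine (Matrix.mul_eq_one_comm_of_card_eq _ _ _ ?_).1 d.V_mul_U
  have := d.dim
  simp only [Fintype.card_sum, Fintype.card_fin]
  omega

theorem conj_mul_U (A : Mat2 d.nhat) (B : Mat2 d.l) :
    d.conj A B * d.U = d.U * Matrix.fromBlocks A 0 0 B := by
  rw [conj, Matrix.mul_assoc, d.V_mul_U, Matrix.mul_one]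

theorem conj_mul_conj (A A' : Mat2 d.nhat) (B B' : Mat2 d.l) :
    d.conj A B * d.conj A' B' = d.conj (A * A') (B * B') := by
  rw [conj.eq_1 d A', ← Matrix.mul_assoc, ← Matrix.mul_assoc, conj_mul_U, conj, Matrix.mul_assoc d.U,
    Matrix.fromBlocks_multiply]
  simp

theorem Pi₀_mul_H : d.Pi₀ * d.H = d.H := by
  simp [Pi₀, H, conj_mul_conj]

theorem H_mul_Pi₀ : d.H * d.Pi₀ = d.H := by
  simp [Pi₀, H, conj_mul_conj]

theorem Piinf_mul_H : d.Piinf * d.H = d.H := by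
  simp [Piinf, H, conj_mul_conj]

theorem H_mul_Piinf : d.H * d.Piinf = d.H := by
  simp [Piinf, H, conj_mul_conj]

/-- `H` acts only on the summand `U₁`, on which both projections are the identity, so its flow
commutes with them. -/
theorem exp_mul_Pi₀ (t : ℝ) :
    NormedSpace.exp (t • d.H) * d.Pi₀ = d.Pi₀ * NormedSpace.exp (t • d.H) :=
  matrix_exp_smul_commute _ _ (by rw [H_mul_Pi₀, Pi₀_mul_H]) t

theorem exp_mul_Piinf (t : ℝ) :
    NormedSpace.exp (t • d.H) * d.Piinf = d.Piinf * NormedSpace.exp (t • d.H) :=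
  matrix_exp_smul_commute _ _ (by rw [H_mul_Piinf, Piinf_mul_H]) t

/-- The kernels of the projections `Π₀` and `Π_∞` meet only in `0`. -/
theorem eq_zero_of_Pi_mulVec {v : Fin n ⊕ Fin n → ℂ} (h₀ : d.Pi₀ *ᵥ v = 0)
    (hi : d.Piinf *ᵥ v = 0) : v = 0 := by
  -- On the summands of `U`, the combination `Π₀ + Π_∞ - Π₀ Π_∞` is the identity.
  have h1 : d.Pi₀ + d.Piinf - d.Pi₀ * d.Piinf = 1 := by
    have h2 : (d.Pi₀ + d.Piinf - d.Pi₀ * d.Piinf) * d.U = d.U := by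
      simp only [Matrix.sub_mul, Matrix.add_mul, Pi₀, Piinf, conj_mul_conj, conj_mul_U,
        ← Matrix.mul_add, ← Matrix.mul_sub]
      conv_rhs => rw [← Matrix.mul_one d.U]
      congr 1
      simp only [sub_eq_add_neg, Matrix.fromBlocks_neg, Matrix.fromBlocks_add,
        Matrix.fromBlocks_multiply]
      simp
    rw [← Matrix.mul_one (_ - _), ← d.U_mul_V, ← Matrix.mul_assoc, h2]
  rw [← Matrix.one_mulVec v, ← h1, Matrix.sub_mulVec, Matrix.add_mulVec, ← Matrix.mulVec_mulVec,
    h₀, hi, Matrix.mulVec_zero]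
  simp

theorem H_mul_J :
    d.H * J n = d.U * Matrix.fromBlocks (d.Hhat * J d.nhat) 0 0 (0 : Mat2 d.l) * (d.U)ᴴ := by
  have e : Matrix.fromBlocks d.Hhat 0 0 (0 : Mat2 d.l) *
      (Matrix.fromBlocks (J d.nhat) 0 0 (J d.l))ᴴ =
      -Matrix.fromBlocks (d.Hhat * J d.nhat) 0 0 0 := by
    simp [Matrix.fromBlocks_conjTranspose, Matrix.fromBlocks_multiply, J_conjTranspose,
      Matrix.fromBlocks_neg]
  calc d.H * J n = d.U * (Matrix.fromBlocks d.Hhat 0 0 (0 : Mat2 d.l) *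
      (Matrix.fromBlocks (J d.nhat) 0 0 (J d.l))ᴴ) * (d.U)ᴴ * (J n * J n) := by
        simp only [H, conj, V, Matrix.mul_assoc]
    _ = _ := by rw [e, J_mul_J]; simp

theorem isHamiltonian_H : IsHamiltonian d.H := by
  have h : (d.Hhat * J d.nhat)ᴴ = d.Hhat * J d.nhat := Eq.symm d.ham
  rw [IsHamiltonian, H_mul_J, Matrix.conjTranspose_mul, Matrix.conjTranspose_mul,
    Matrix.fromBlocks_conjTranspose, Matrix.conjTranspose_conjTranspose, h]
  simp only [Matrix.conjTranspose_zero, Matrix.mul_assoc]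

/-- At time `1` the given pair `(M, L)` satisfies the linear system. -/
theorem mul_Pi₀_eq : M * d.Pi₀ = L * d.Piinf * NormedSpace.exp d.H := by
  have hH : d.H * d.U₁ = d.U₁ * d.Hhat ∧
      d.H * d.Uinf = d.Uinf * (0 : Matrix (Fin d.l) (Fin d.l) ℂ) := by
    have h := d.conj_mul_U d.Hhat 0
    rw [U, Matrix.mul_fromCols, Matrix.mul_fromCols, Matrix.fromCols_mul_fromBlocks] at h
    obtain ⟨h1, h2⟩ := Matrix.fromCols_inj h
    simp only [Matrix.mul_zero, add_zero] at h1 h2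
    obtain ⟨-, h3⟩ := Matrix.fromCols_inj (h2.trans Matrix.fromCols_zero.symm)
    exact ⟨h1, by rw [Matrix.mul_zero]; exact h3⟩
  have h1 : NormedSpace.exp d.H * d.U₁ = d.U₁ * d.Shat := by
    have := exp_smul_mul_of_intertwine hH.1 1
    rwa [one_smul, one_smul, d.exp_eq] at this
  have h2 : NormedSpace.exp d.H * d.Uinf = d.Uinf := by
    have := exp_smul_mul_of_intertwine hH.2 1
    rwa [one_smul, one_smul, NormedSpace.exp_zero, Matrix.mul_one] at this
  have hP₀ : d.Pi₀ * d.U = Matrix.fromCols d.U₁ (Matrix.fromCols d.U₀ 0) := by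
    rw [Pi₀, conj_mul_U, U, Matrix.fromCols_mul_fromBlocks, Matrix.fromCols_mul_fromBlocks]
    simp
  have hPi : d.Piinf * d.U = Matrix.fromCols d.U₁ (Matrix.fromCols 0 d.Uinf) := by
    rw [Piinf, conj_mul_U, U, Matrix.fromCols_mul_fromBlocks, Matrix.fromCols_mul_fromBlocks]
    simp
  have hcomm : NormedSpace.exp d.H * d.Piinf = d.Piinf * NormedSpace.exp d.H := by
    simpa using d.exp_mul_Piinf 1
  have key : M * d.Pi₀ * d.U = L * d.Piinf * NormedSpace.exp d.H * d.U := by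
    rw [Matrix.mul_assoc L, ← hcomm, Matrix.mul_assoc, hP₀, Matrix.mul_assoc, Matrix.mul_assoc, hPi]
    simp only [Matrix.mul_fromCols, h1, h2, d.zero_eq, d.inf_eq, d.fin_eq, Matrix.mul_zero,
      Matrix.mul_assoc]
  rw [← Matrix.mul_one (M * _), ← Matrix.mul_one (L * _ * _), ← d.U_mul_V, ← Matrix.mul_assoc,
    ← Matrix.mul_assoc, key]

end SpectralData

/-! ### Uniqueness for the linear system -/

/-- At a time at which the system has a solution `X`, its homogeneous version has only the zero
solution. With `S₂ Π₀ = [A₁; A₂]` and `S₁ Π_∞ e^{Ht} = [C₁; C₂]` the system reads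
`X [-C₂; A₁] = [C₁; -A₂]`. A vector killed by `[-C₂; A₁]` is then killed by all four blocks, hence
by `Π₀` and `Π_∞`, hence is zero; so `[-C₂; A₁]` is invertible. -/
theorem eq_zero_of_solvable {M L S₁ S₂ : Mat2 n} (d : SpectralData M L)
    (hS₁ : IsSymplectic S₁) (hS₂ : IsSymplectic S₂) {t : ℝ} {X : Mat2 n}
    (hX : (T S₁ S₂ X).1 * d.Pi₀ = (T S₁ S₂ X).2 * d.Piinf * NormedSpace.exp (t • d.H))
    {m : Type*} {α β : Matrix m (Fin n) ℂ}
    (h : Matrix.fromCols α (0 : Matrix m (Fin n) ℂ) * S₂ * d.Pi₀ =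
      Matrix.fromCols (0 : Matrix m (Fin n) ℂ) β * S₁ * d.Piinf * NormedSpace.exp (t • d.H)) :
    α = 0 ∧ β = 0 := by
  set E := NormedSpace.exp (t • d.H)
  have hEu : IsUnit E := Matrix.isUnit_exp _
  obtain ⟨A₁, A₂, hA⟩ : ∃ A₁ A₂, S₂ * d.Pi₀ = Matrix.fromRows A₁ A₂ :=
    ⟨_, _, (Matrix.fromRows_toRows _).symm⟩
  obtain ⟨C₁, C₂, hC⟩ : ∃ C₁ C₂, S₁ * d.Piinf * E = Matrix.fromRows C₁ C₂ :=
    ⟨_, _, (Matrix.fromRows_toRows _).symm⟩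
  have h' : Matrix.fromCols β α * Matrix.fromRows (-C₂) A₁ = 0 := by
    rw [Matrix.mul_assoc, hA, Matrix.mul_assoc, Matrix.mul_assoc, ← Matrix.mul_assoc S₁, hC,
      Matrix.fromCols_mul_fromRows, Matrix.fromCols_mul_fromRows] at h
    rw [Matrix.fromCols_mul_fromRows]
    simpa [Matrix.mul_neg, neg_add_eq_zero] using h.symm
  have hX' : X * Matrix.fromRows (-C₂) A₁ = Matrix.fromRows C₁ (-A₂) := by
    simp only [T] at hX
    rw [Matrix.mul_assoc, hA, Matrix.mul_assoc, Matrix.mul_assoc, ← Matrix.mul_assoc S₁, hC,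
      Matrix.fromBlocks_mul_fromRows, Matrix.fromBlocks_mul_fromRows, Matrix.fromRows_ext_iff] at hX
    obtain ⟨h1, h2⟩ := hX
    simp only [Matrix.zero_mul, add_zero, Matrix.one_mul, zero_add] at h1 h2
    conv_lhs => rw [← Matrix.fromBlocks_toBlocks X]
    rw [Matrix.fromBlocks_mul_fromRows, h1, Matrix.mul_neg, Matrix.mul_neg, ← h2]
    congr 1 <;> abel
  have hu : IsUnit (Matrix.fromRows (-C₂) A₁ : Mat2 n) := by
    rw [← Matrix.mulVec_injective_iff_isUnit]
    refine (injective_iff_map_eq_zero (Matrix.mulVecLin (Matrix.fromRows (-C₂) A₁ : Mat2 n))).2 ?_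
    intro v hv
    rw [Matrix.mulVecLin_apply] at hv
    have hv2 : Matrix.fromRows C₁ (-A₂) *ᵥ v = 0 := by
      rw [← hX', ← Matrix.mulVec_mulVec, hv, Matrix.mulVec_zero]
    have sp : ∀ {a b : Fin n → ℂ}, Sum.elim a b = 0 ↔ a = 0 ∧ b = 0 := by
      intro a b
      rw [← Sum.elim_zero_zero, Sum.elim_eq_iff]
    rw [Matrix.fromRows_mulVec, sp, Matrix.neg_mulVec, neg_eq_zero] at hv hv2
    have e1 : (S₂ * d.Pi₀) *ᵥ v = 0 := by
      rw [hA, Matrix.fromRows_mulVec, sp]; exact ⟨hv.2, hv2.2⟩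
    have e2 : (S₁ * E * d.Piinf) *ᵥ v = 0 := by
      rw [Matrix.mul_assoc, d.exp_mul_Piinf, ← Matrix.mul_assoc, hC, Matrix.fromRows_mulVec, sp]
      exact ⟨hv2.1, hv.1⟩
    rw [← Matrix.mulVec_mulVec] at e1 e2
    refine d.eq_zero_of_Pi_mulVec ?_ ?_
    · exact Matrix.mulVec_injective_of_isUnit hS₂.isUnit (by rw [e1, Matrix.mulVec_zero])
    · exact Matrix.mulVec_injective_of_isUnit (hS₁.isUnit.mul hEu) (by rw [e2, Matrix.mulVec_zero])
  have h0 : Matrix.fromCols β α = 0 := by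
    have hd := (Matrix.isUnit_iff_isUnit_det _).1 hu
    have := congrArg (· * (Matrix.fromRows (-C₂) A₁ : Mat2 n)⁻¹) h'
    simpa only [Matrix.mul_nonsing_inv_cancel_right _ _ hd, Matrix.zero_mul] using this
  obtain ⟨h1, h2⟩ := Matrix.fromCols_inj (h0.trans Matrix.fromCols_zero.symm)
  exact ⟨h2, h1⟩

theorem solution_unique {M L S₁ S₂ : Mat2 n} (d : SpectralData M L)
    (hS₁ : IsSymplectic S₁) (hS₂ : IsSymplectic S₂) {t : ℝ} {X X' : Mat2 n}
    (hX : (T S₁ S₂ X).1 * d.Pi₀ = (T S₁ S₂ X).2 * d.Piinf * NormedSpace.exp (t • d.H))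
    (hX' : (T S₁ S₂ X').1 * d.Pi₀ = (T S₁ S₂ X').2 * d.Piinf * NormedSpace.exp (t • d.H)) :
    X = X' := by
  have e1 : (T S₁ S₂ X).1 - (T S₁ S₂ X').1 = Matrix.fromCols
      (Matrix.fromRows (X.toBlocks₁₂ - X'.toBlocks₁₂) (X.toBlocks₂₂ - X'.toBlocks₂₂)) 0 * S₂ := by
    simp only [T, ← Matrix.sub_mul]
    congr 1
    ext (i | i) (j | j) <;> simp
  have e2 : (T S₁ S₂ X).2 - (T S₁ S₂ X').2 = Matrix.fromCols 0
      (Matrix.fromRows (X.toBlocks₁₁ - X'.toBlocks₁₁) (X.toBlocks₂₁ - X'.toBlocks₂₁)) * S₁ := by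
    simp only [T, ← Matrix.sub_mul]
    congr 1
    ext (i | i) (j | j) <;> simp
  have h : Matrix.fromCols
      (Matrix.fromRows (X.toBlocks₁₂ - X'.toBlocks₁₂) (X.toBlocks₂₂ - X'.toBlocks₂₂)) 0 * S₂
      * d.Pi₀ = Matrix.fromCols 0
      (Matrix.fromRows (X.toBlocks₁₁ - X'.toBlocks₁₁) (X.toBlocks₂₁ - X'.toBlocks₂₁)) * S₁
      * d.Piinf * NormedSpace.exp (t • d.H) := by
    rw [← e1, ← e2, Matrix.sub_mul, Matrix.sub_mul, Matrix.sub_mul, hX, hX']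
  obtain ⟨h1, h2⟩ := eq_zero_of_solvable d hS₁ hS₂ hX h
  obtain ⟨h3, h4⟩ := Matrix.fromRows_inj (h1.trans Matrix.fromRows_zero.symm)
  obtain ⟨h5, h6⟩ := Matrix.fromRows_inj (h2.trans Matrix.fromRows_zero.symm)
  exact Matrix.ext_iff_blocks.2
    ⟨sub_eq_zero.1 h5, sub_eq_zero.1 h3, sub_eq_zero.1 h6, sub_eq_zero.1 h4⟩

/-! ### The linear flows and the solutions they produce -/

theorem hasDerivAt_fromRows_iff {ι₁ ι₂ κ : Type*} [Fintype ι₁] [Fintype ι₂] [Fintype κ]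
    {f : ℝ → Matrix ι₁ κ ℂ} {g : ℝ → Matrix ι₂ κ ℂ} {f' : Matrix ι₁ κ ℂ} {g' : Matrix ι₂ κ ℂ}
    {t : ℝ} :
    HasDerivAt (fun s => Matrix.fromRows (f s) (g s)) (Matrix.fromRows f' g') t ↔
      HasDerivAt f f' t ∧ HasDerivAt g g' t := by
  simp only [hasDerivAt_matrix_iff, Sum.forall, Matrix.fromRows_apply_inl,
    Matrix.fromRows_apply_inr]

theorem IsLinearFlow.hasDerivAt {A B C D W : Mat1 n}
    {Q P : ℝ → Mat1 n} (h : IsLinearFlow (Matrix.fromBlocks A B C D) W Q P)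
    (t : ℝ) : HasDerivAt Q (A * Q t + B * P t) t ∧ HasDerivAt P (C * Q t + D * P t) t := by
  have := h.1 t
  rwa [Matrix.fromBlocks_mul_fromRows, hasDerivAt_fromRows_iff] at this

theorem conjTranspose_eq_mul_exp {G : Mat2 n} {W₁ W₂ : Mat1 n}
    {f g : ℝ → Mat1 n}
    (h : ∀ t, HasDerivAt (fun s => Matrix.fromRows (f s) (g s))
      (Gᴴ * Matrix.fromRows (f t) (g t)) t)
    (h₁ : (f 0)ᴴ = W₁) (h₂ : (g 0)ᴴ = W₂) (t : ℝ) :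
    Matrix.fromCols (f t)ᴴ (g t)ᴴ = Matrix.fromCols W₁ W₂ * NormedSpace.exp (t • G) := by
  have := congrArg Matrix.conjTranspose (eq_exp_smul_mul _ _ h t)
  rwa [Matrix.conjTranspose_mul, Matrix.conjTranspose_fromRows_eq_fromCols_conjTranspose,
    Matrix.conjTranspose_fromRows_eq_fromCols_conjTranspose, ← Matrix.exp_conjTranspose,
    Matrix.conjTranspose_smul, Matrix.conjTranspose_conjTranspose, star_trivial, h₁, h₂] at this

theorem IsSymplectic.exp_conj_mul {S : Mat2 n} (hS : IsSymplectic S) (H : Mat2 n) (t : ℝ) :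
    NormedSpace.exp (t • (S * H * S⁻¹)) * S = S * NormedSpace.exp (t • H) :=
  exp_smul_mul_of_intertwine (by rw [Matrix.mul_assoc, hS.inv_mul, Matrix.mul_one]) t

/-- In row form the flow of `[Q; P]` is the right action of `e^{sH}` on the lower rows
`[X₂₂, I] S₂` of `M`; this uses the block structure of the Hamiltonian matrix `S₂ H S₂⁻¹`. -/
theorem flow_Htilde {S₂ H : Mat2 n} {w : Mat1 n} (hS₂ : IsSymplectic S₂)
    (hH : IsHamiltonian H) (hw : wᴴ = w) {Q P : ℝ → Mat1 n}
    (h : IsLinearFlow (Htilde S₂ H) w Q P) (s : ℝ) :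
    Matrix.fromCols (P s)ᴴ (Q s)ᴴ * S₂ =
      Matrix.fromCols w (1 : Mat1 n) * S₂ * NormedSpace.exp (s • H) := by
  obtain ⟨h1, h2, h3⟩ := (hH.conj hS₂).blocks
  have hG : (S₂ * H * S₂⁻¹)ᴴ = Matrix.fromBlocks ((S₂ * H * S₂⁻¹).toBlocks₁₁)ᴴ
      (S₂ * H * S₂⁻¹).toBlocks₂₁ (S₂ * H * S₂⁻¹).toBlocks₁₂ (-(S₂ * H * S₂⁻¹).toBlocks₁₁) := by
    conv_lhs => rw [← Matrix.fromBlocks_toBlocks (S₂ * H * S₂⁻¹), Matrix.fromBlocks_conjTranspose]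
    rw [h1, h2, h3]; simp
  rw [conjTranspose_eq_mul_exp (G := S₂ * H * S₂⁻¹) (W₁ := w) (W₂ := 1), Matrix.mul_assoc,
    hS₂.exp_conj_mul, Matrix.mul_assoc]
  · intro t
    have := h.hasDerivAt t
    rw [hG, Matrix.fromBlocks_mul_fromRows, hasDerivAt_fromRows_iff]
    refine ⟨by rw [add_comm]; exact this.2, by rw [add_comm]; exact this.1⟩
  · rw [h.2.2, hw]
  · rw [h.2.1, Matrix.conjTranspose_one]

/-- In row form the flow of `[Q⋆; P⋆]` is the right action of `e^{-sH}` on the upper rows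
`[I, X₁₁] S₁` of `L`, since `H̃⋆ = -(S₁ H S₁⁻¹)ᴴ`. -/
theorem flow_HtildeStar {S₁ H : Mat2 n} {w : Mat1 n} (hS₁ : IsSymplectic S₁)
    (hH : IsHamiltonian H) (hw : wᴴ = w) {Q P : ℝ → Mat1 n}
    (h : IsLinearFlow (HtildeStar S₁ H) w Q P) (s : ℝ) :
    Matrix.fromCols (Q s)ᴴ (P s)ᴴ * S₁ =
      Matrix.fromCols (1 : Mat1 n) w * S₁ * NormedSpace.exp ((-s) • H) := by
  obtain ⟨h1, h2, h3⟩ := (hH.conj hS₁).blocks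
  have hG : (-(S₁ * H * S₁⁻¹))ᴴ = HtildeStar S₁ H := by
    conv_lhs => rw [← Matrix.fromBlocks_toBlocks (S₁ * H * S₁⁻¹), Matrix.conjTranspose_neg,
      Matrix.fromBlocks_conjTranspose]
    rw [h1, h2, h3, HtildeStar, Matrix.fromBlocks_neg]; simp
  rw [conjTranspose_eq_mul_exp (G := -(S₁ * H * S₁⁻¹)) (W₁ := 1) (W₂ := w), Matrix.mul_assoc,
    smul_neg, ← neg_smul, hS₁.exp_conj_mul, Matrix.mul_assoc]
  · intro t
    rw [hG]; exact h.1 t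
  · rw [h.2.1, Matrix.conjTranspose_one]
  · rw [h.2.2, hw]

theorem exp_smul_mul_exp_smul (H : Mat2 n) (a b : ℝ) :
    NormedSpace.exp (a • H) * NormedSpace.exp (b • H) = NormedSpace.exp ((a + b) • H) := by
  rw [add_smul, Matrix.exp_add_of_commute]
  exact ((Commute.refl H).smul_left a).smul_right b

/-- The system at time `1` becomes the system at time `t` when the initial pair is moved by the flow;
the shift `t - 1` can be put on `M`, on `L`, or split between them. -/
theorem shifted_system {M L : Mat2 n} (d : SpectralData M L) {a b t : ℝ} (hab : 1 + a = b + t) :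
    M * NormedSpace.exp (a • d.H) * d.Pi₀ =
      L * NormedSpace.exp (b • d.H) * d.Piinf * NormedSpace.exp (t • d.H) := by
  rw [Matrix.mul_assoc, d.exp_mul_Pi₀, ← Matrix.mul_assoc, d.mul_Pi₀_eq,
    Matrix.mul_assoc L _ d.Piinf, d.exp_mul_Piinf]
  have : NormedSpace.exp d.H * NormedSpace.exp (a • d.H) =
      NormedSpace.exp (b • d.H) * NormedSpace.exp (t • d.H) := by
    rw [exp_smul_mul_exp_smul, ← hab, ← exp_smul_mul_exp_smul, one_smul]
  simp only [Matrix.mul_assoc, this]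

/-- A pair `T(X)` that is left-equivalent to the shifted initial pair comes from a Hermitian `X` and
solves the system at time `t`. -/
theorem solution_of_transform {S₁ S₂ X₁ X F : Mat2 n} (hS₁ : IsSymplectic S₁)
    (hS₂ : IsSymplectic S₂) (hX₁ : X₁.IsHermitian)
    (d : SpectralData (T S₁ S₂ X₁).1 (T S₁ S₂ X₁).2) {a b t : ℝ} (hab : 1 + a = b + t)
    (h1 : (T S₁ S₂ X).1 = F * ((T S₁ S₂ X₁).1 * NormedSpace.exp (a • d.H)))
    (h2 : (T S₁ S₂ X).2 = F * ((T S₁ S₂ X₁).2 * NormedSpace.exp (b • d.H))) :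
    X.IsHermitian ∧
      (T S₁ S₂ X).1 * d.Pi₀ = (T S₁ S₂ X).2 * d.Piinf * NormedSpace.exp (t • d.H) := by
  have e : ∀ (A : Mat2 n) (c : ℝ), F * (A * NormedSpace.exp (c • d.H)) * J n *
      (F * (A * NormedSpace.exp (c • d.H)))ᴴ = F * (A * J n * Aᴴ) * Fᴴ := by
    intro A c
    have h : NormedSpace.exp (c • d.H) * J n * (NormedSpace.exp (c • d.H))ᴴ = J n :=
      d.isHamiltonian_H.isSymplectic_exp c
    conv_rhs => rw [← h]
    simp only [Matrix.conjTranspose_mul, Matrix.mul_assoc]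
  constructor
  · rw [isHermitian_iff_T hS₁ hS₂, h1, h2, e, e, (isHermitian_iff_T hS₁ hS₂ X₁).1 hX₁]
  · rw [h1, h2, Matrix.mul_assoc F, shifted_system d hab]
    simp only [Matrix.mul_assoc]

theorem T_fst_mul {S₁ S₂ X E : Mat2 n} {a b p q : Mat1 n}
    (h1 : Matrix.fromCols X.toBlocks₁₂ (0 : Mat1 n) * S₂ * E = Matrix.fromCols a b * S₂)
    (h2 : Matrix.fromCols X.toBlocks₂₂ (1 : Mat1 n) * S₂ * E = Matrix.fromCols p q * S₂) :
    (T S₁ S₂ X).1 * E = Matrix.fromBlocks a b p q * S₂ := by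
  simp only [T]
  rw [← Matrix.fromRows_fromCols_eq_fromBlocks, ← Matrix.fromRows_fromCols_eq_fromBlocks,
    Matrix.fromRows_mul, Matrix.fromRows_mul, Matrix.fromRows_mul, h1, h2]

theorem T_snd_mul {S₁ S₂ X E : Mat2 n} {a b p q : Mat1 n}
    (h1 : Matrix.fromCols (1 : Mat1 n) X.toBlocks₁₁ * S₁ * E = Matrix.fromCols q p * S₁)
    (h2 : Matrix.fromCols (0 : Mat1 n) X.toBlocks₂₁ * S₁ * E = Matrix.fromCols a b * S₁) :
    (T S₁ S₂ X).2 * E = Matrix.fromBlocks q p a b * S₁ := by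
  simp only [T]
  rw [← Matrix.fromRows_fromCols_eq_fromBlocks, ← Matrix.fromRows_fromCols_eq_fromBlocks,
    Matrix.fromRows_mul, Matrix.fromRows_mul, Matrix.fromRows_mul, h1, h2]

theorem exists_row_mul_eq {S : Mat2 n} (hS : IsSymplectic S)
    (R : Matrix (Fin n) (Fin n ⊕ Fin n) ℂ) : ∃ a b : Mat1 n, R = Matrix.fromCols a b * S := by
  refine ⟨(R * S⁻¹).toCols₁, (R * S⁻¹).toCols₂, ?_⟩
  rw [Matrix.fromCols_toCols, Matrix.mul_assoc, hS.inv_mul, Matrix.mul_one]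

/-- Let `(M, L) = T(X₁)`. If the lower right block `q` of `M e^{(t-1)H} S₂⁻¹` is invertible, left
multiplication brings the pair `(M e^{(t-1)H}, L)` to the normal form `T(X)`, and the lower blocks
of `X` can be read off. -/
theorem exists_solution_of_isUnit {S₁ S₂ X₁ : Mat2 n} (hS₁ : IsSymplectic S₁)
    (hS₂ : IsSymplectic S₂) (hX₁ : X₁.IsHermitian)
    (d : SpectralData (T S₁ S₂ X₁).1 (T S₁ S₂ X₁).2) {t : ℝ} {p q : Mat1 n}
    (hpq : Matrix.fromCols p q * S₂ =
      Matrix.fromCols X₁.toBlocks₂₂ (1 : Mat1 n) * S₂ * NormedSpace.exp ((t - 1) • d.H))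
    (hq : IsUnit q) :
    ∃ X : Mat2 n, X.IsHermitian ∧
      (T S₁ S₂ X).1 * d.Pi₀ = (T S₁ S₂ X).2 * d.Piinf * NormedSpace.exp (t • d.H) ∧
      X.toBlocks₂₁ = q⁻¹ * X₁.toBlocks₂₁ ∧ X.toBlocks₂₂ = q⁻¹ * p := by
  obtain ⟨a, b, hab⟩ := exists_row_mul_eq hS₂ (Matrix.fromCols X₁.toBlocks₁₂ (0 : Mat1 n) * S₂ *
      NormedSpace.exp ((t - 1) • d.H))
  have hM := T_fst_mul (S₁ := S₁) hab hpq.symm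
  have hq' := Matrix.nonsing_inv_mul q ((Matrix.isUnit_iff_isUnit_det _).1 hq)
  -- Block elimination with pivot `q`: it turns the second block column `[b; q]` of the first matrix
  -- into `[0; 1]` and leaves the first block column `[1; 0]` of the second matrix unchanged.
  have := solution_of_transform (a := t - 1) (b := 0) (t := t)
    (X := Matrix.fromBlocks (X₁.toBlocks₁₁ - b * q⁻¹ * X₁.toBlocks₂₁) (a - b * q⁻¹ * p)
      (q⁻¹ * X₁.toBlocks₂₁) (q⁻¹ * p)) (F := Matrix.fromBlocks 1 (-(b * q⁻¹)) 0 q⁻¹)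
      hS₁ hS₂ hX₁ d (by ring) ?_ ?_
  · exact ⟨_, this.1, this.2, by simp, by simp⟩
  · rw [hM, ← Matrix.mul_assoc, Matrix.fromBlocks_multiply]
    simp [T, hq', Matrix.mul_assoc, sub_eq_add_neg]
  · simp only [zero_smul, NormedSpace.exp_zero, Matrix.mul_one]
    simp only [T]
    rw [← Matrix.mul_assoc, Matrix.fromBlocks_multiply]
    simp [Matrix.mul_assoc, sub_eq_add_neg]

/-- The mirror image of `exists_solution_of_isUnit`, with the shift put on `L`: here the upper blocks
of `X` can be read off. -/
theorem exists_solution_of_isUnit_star {S₁ S₂ X₁ : Mat2 n} (hS₁ : IsSymplectic S₁)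
    (hS₂ : IsSymplectic S₂) (hX₁ : X₁.IsHermitian)
    (d : SpectralData (T S₁ S₂ X₁).1 (T S₁ S₂ X₁).2) {t : ℝ} {p q : Mat1 n}
    (hqp : Matrix.fromCols q p * S₁ =
      Matrix.fromCols (1 : Mat1 n) X₁.toBlocks₁₁ * S₁ * NormedSpace.exp ((-(t - 1)) • d.H))
    (hq : IsUnit q) :
    ∃ X : Mat2 n, X.IsHermitian ∧
      (T S₁ S₂ X).1 * d.Pi₀ = (T S₁ S₂ X).2 * d.Piinf * NormedSpace.exp (t • d.H) ∧
      X.toBlocks₁₂ = q⁻¹ * X₁.toBlocks₁₂ ∧ X.toBlocks₁₁ = q⁻¹ * p := by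
  obtain ⟨a, b, hab⟩ := exists_row_mul_eq hS₁ (Matrix.fromCols (0 : Mat1 n) X₁.toBlocks₂₁ * S₁ *
      NormedSpace.exp ((-(t - 1)) • d.H))
  have hL := T_snd_mul (S₂ := S₂) hqp.symm hab
  have hq' := Matrix.nonsing_inv_mul q ((Matrix.isUnit_iff_isUnit_det _).1 hq)
  have := solution_of_transform (a := 0) (b := -(t - 1)) (t := t)
    (X := Matrix.fromBlocks (q⁻¹ * p) (q⁻¹ * X₁.toBlocks₁₂)
      (b - a * q⁻¹ * p) (X₁.toBlocks₂₂ - a * q⁻¹ * X₁.toBlocks₁₂))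
      (F := Matrix.fromBlocks q⁻¹ 0 (-(a * q⁻¹)) 1)
      hS₁ hS₂ hX₁ d (by ring) ?_ ?_
  · exact ⟨_, this.1, this.2, by simp, by simp⟩
  · simp only [zero_smul, NormedSpace.exp_zero, Matrix.mul_one]
    simp only [T]
    rw [← Matrix.mul_assoc, Matrix.fromBlocks_multiply]
    simp [Matrix.mul_assoc, sub_eq_neg_add]
  · rw [hL, ← Matrix.mul_assoc, Matrix.fromBlocks_multiply]
    simp [T, hq', Matrix.mul_assoc, sub_eq_neg_add]

theorem isUnit_of_forall_row {q : Mat1 n}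
    (h : ∀ N : Matrix Unit (Fin n) ℂ, N * q = 0 → N = 0) : IsUnit q := by
  rw [← Matrix.vecMul_injective_iff_isUnit]
  refine (injective_iff_map_eq_zero (Matrix.vecMulLinear q)).2 fun w hw => ?_
  have := h (Matrix.replicateRow Unit w) (by
    rw [← Matrix.replicateRow_vecMul, ← Matrix.vecMulLinear_apply, hw]; rfl)
  funext j
  exact congrFun (congrFun this ()) j

/-- Solvability at time `t` forces the pivot block `q` to be invertible: a row `N` with `N q = 0`
turns the lower rows of the shifted pair into a homogeneous solution, which vanishes by
`eq_zero_of_solvable`, and `[X₂₂, I]` has full row rank. -/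
theorem isUnit_of_solvable {S₁ S₂ X₁ X : Mat2 n} (hS₁ : IsSymplectic S₁)
    (hS₂ : IsSymplectic S₂)
    (d : SpectralData (T S₁ S₂ X₁).1 (T S₁ S₂ X₁).2) {t : ℝ} {p q : Mat1 n}
    (hpq : Matrix.fromCols p q * S₂ =
      Matrix.fromCols X₁.toBlocks₂₂ (1 : Mat1 n) * S₂ * NormedSpace.exp ((t - 1) • d.H))
    (hX : (T S₁ S₂ X).1 * d.Pi₀ = (T S₁ S₂ X).2 * d.Piinf * NormedSpace.exp (t • d.H)) :
    IsUnit q := by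
  refine isUnit_of_forall_row fun N hN => ?_
  have hs := shifted_system d (a := t - 1) (b := 0) (t := t) (by ring)
  rw [zero_smul, NormedSpace.exp_zero, Matrix.mul_one] at hs
  have h0 : N * Matrix.fromCols p q = Matrix.fromCols (N * p) 0 := by
    rw [Matrix.mul_fromCols, hN]
  have hM : Matrix.fromCols X₁.toBlocks₂₂ (1 : Mat1 n) * S₂ =
      Matrix.fromCols (0 : Mat1 n) (1 : Mat1 n) * (T S₁ S₂ X₁).1 := by
    simp only [T]
    rw [← Matrix.mul_assoc, Matrix.fromCols_mul_fromBlocks]; simp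
  have hL : Matrix.fromCols (0 : Mat1 n) X₁.toBlocks₂₁ * S₁ =
      Matrix.fromCols (0 : Mat1 n) (1 : Mat1 n) * (T S₁ S₂ X₁).2 := by
    simp only [T]
    rw [← Matrix.mul_assoc, Matrix.fromCols_mul_fromBlocks]; simp
  have hp := (eq_zero_of_solvable d hS₁ hS₂ hX (α := N * p) (β := N * X₁.toBlocks₂₁) (by
    rw [← h0, Matrix.mul_assoc N, hpq, hM, ← Matrix.mul_zero N, ← Matrix.mul_fromCols,
      Matrix.mul_assoc N (Matrix.fromCols 0 _), hL]
    simp only [Matrix.mul_assoc] at hs ⊢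
    rw [hs])).1
  rw [hp, Matrix.fromCols_zero] at h0
  have h1 : N * Matrix.fromCols X₁.toBlocks₂₂ (1 : Mat1 n) *
      (S₂ * NormedSpace.exp ((t - 1) • d.H)) = 0 := by
    rw [Matrix.mul_assoc, ← Matrix.mul_assoc _ S₂, ← hpq, ← Matrix.mul_assoc, h0, Matrix.zero_mul]
  have hu := (Matrix.isUnit_iff_isUnit_det _).1
    (hS₂.isUnit.mul (Matrix.isUnit_exp ((t - 1) • d.H)))
  have h2 := congrArg (· * (S₂ * NormedSpace.exp ((t - 1) • d.H))⁻¹) h1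
  simp only [Matrix.mul_nonsing_inv_cancel_right _ _ hu, Matrix.zero_mul] at h2
  rw [Matrix.mul_fromCols, Matrix.mul_one] at h2
  exact (Matrix.fromCols_inj (h2.trans Matrix.fromCols_zero.symm)).2

/-- The mirror image of `isUnit_of_solvable`, for the upper rows with the shift put on `L`. -/
theorem isUnit_of_solvable_star {S₁ S₂ X₁ X : Mat2 n} (hS₁ : IsSymplectic S₁)
    (hS₂ : IsSymplectic S₂)
    (d : SpectralData (T S₁ S₂ X₁).1 (T S₁ S₂ X₁).2) {t : ℝ} {p q : Mat1 n}
    (hqp : Matrix.fromCols q p * S₁ =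
      Matrix.fromCols (1 : Mat1 n) X₁.toBlocks₁₁ * S₁ * NormedSpace.exp ((-(t - 1)) • d.H))
    (hX : (T S₁ S₂ X).1 * d.Pi₀ = (T S₁ S₂ X).2 * d.Piinf * NormedSpace.exp (t • d.H)) :
    IsUnit q := by
  refine isUnit_of_forall_row fun N hN => ?_
  have hs := shifted_system d (a := 0) (b := -(t - 1)) (t := t) (by ring)
  rw [zero_smul, NormedSpace.exp_zero, Matrix.mul_one] at hs
  have h0 : N * Matrix.fromCols q p = Matrix.fromCols 0 (N * p) := by
    rw [Matrix.mul_fromCols, hN]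
  have hL : Matrix.fromCols (1 : Mat1 n) X₁.toBlocks₁₁ * S₁ =
      Matrix.fromCols (1 : Mat1 n) (0 : Mat1 n) * (T S₁ S₂ X₁).2 := by
    simp only [T]
    rw [← Matrix.mul_assoc, Matrix.fromCols_mul_fromBlocks]; simp
  have hM : Matrix.fromCols X₁.toBlocks₁₂ (0 : Mat1 n) * S₂ =
      Matrix.fromCols (1 : Mat1 n) (0 : Mat1 n) * (T S₁ S₂ X₁).1 := by
    simp only [T]
    rw [← Matrix.mul_assoc, Matrix.fromCols_mul_fromBlocks]; simp
  have hp := (eq_zero_of_solvable d hS₁ hS₂ hX (α := N * X₁.toBlocks₁₂) (β := N * p) (by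
    rw [← h0, Matrix.mul_assoc N, hqp, hL, ← Matrix.mul_zero N, ← Matrix.mul_fromCols,
      Matrix.mul_assoc N (Matrix.fromCols _ 0), hM]
    simp only [Matrix.mul_assoc] at hs ⊢
    rw [hs])).2
  rw [hp, Matrix.fromCols_zero] at h0
  have h1 : N * Matrix.fromCols (1 : Mat1 n) X₁.toBlocks₁₁ *
      (S₁ * NormedSpace.exp ((-(t - 1)) • d.H)) = 0 := by
    rw [Matrix.mul_assoc, ← Matrix.mul_assoc _ S₁, ← hqp, ← Matrix.mul_assoc, h0, Matrix.zero_mul]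
  have hu := (Matrix.isUnit_iff_isUnit_det _).1
    (hS₁.isUnit.mul (Matrix.isUnit_exp ((-(t - 1)) • d.H)))
  have h2 := congrArg (· * (S₁ * NormedSpace.exp ((-(t - 1)) • d.H))⁻¹) h1
  simp only [Matrix.mul_nonsing_inv_cancel_right _ _ hu, Matrix.zero_mul] at h2
  rw [Matrix.mul_fromCols, Matrix.mul_one] at h2
  exact (Matrix.fromCols_inj (h2.trans Matrix.fromCols_zero.symm)).1

/-! ### The differential equation -/

/-- Along a solution `M H 𝒥 Mᴴ = L H 𝒥 Lᴴ`. So the first block column of the velocity can be computed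
from `L` and `S₁`, and the second from `M` and `S₂`. -/
theorem velocity_eq {M₁ L₁ M L : Mat2 n} (d : SpectralData M₁ L₁) {t : ℝ}
    (h : M * d.Pi₀ = L * d.Piinf * NormedSpace.exp (t • d.H)) :
    M * d.H * J n * Mᴴ = L * d.H * J n * Lᴴ := by
  have hJ := Eq.symm d.isHamiltonian_H
  have adj : ∀ {P : Mat2 n}, P * d.H = d.H → d.H * J n * Pᴴ = d.H * J n := by
    intro P hP
    rw [← hJ, ← Matrix.conjTranspose_mul, ← Matrix.mul_assoc, hP]
  have hE : NormedSpace.exp (t • d.H) * J n * (NormedSpace.exp (t • d.H))ᴴ = J n :=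
    d.isHamiltonian_H.isSymplectic_exp t
  have e1 : M * d.H * J n * Mᴴ = (M * d.Pi₀) * (d.H * J n) * (M * d.Pi₀)ᴴ := by
    rw [Matrix.conjTranspose_mul]
    calc _ = M * (d.H * J n) * Mᴴ := by simp only [Matrix.mul_assoc]
      _ = M * ((d.Pi₀ * d.H) * J n * (d.Pi₀)ᴴ) * Mᴴ := by
        rw [d.Pi₀_mul_H, adj d.Pi₀_mul_H]
      _ = _ := by simp only [Matrix.mul_assoc]
  rw [e1, h, Matrix.conjTranspose_mul, Matrix.conjTranspose_mul]
  calc _ = L * d.Piinf * (NormedSpace.exp (t • d.H) * d.H * J n *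
        (NormedSpace.exp (t • d.H))ᴴ) * ((d.Piinf)ᴴ * Lᴴ) := by simp only [Matrix.mul_assoc]
    _ = L * d.Piinf * (d.H * (NormedSpace.exp (t • d.H) * J n *
        (NormedSpace.exp (t • d.H))ᴴ)) * ((d.Piinf)ᴴ * Lᴴ) := by
      rw [matrix_exp_smul_commute d.H d.H rfl]; simp only [Matrix.mul_assoc]
    _ = L * ((d.Piinf * d.H) * J n * (d.Piinf)ᴴ) * Lᴴ := by
      rw [hE]; simp only [Matrix.mul_assoc]
    _ = L * d.H * J n * Lᴴ := by
      rw [d.Piinf_mul_H, adj d.Piinf_mul_H]; simp only [Matrix.mul_assoc]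

/-- A symplectic factor of the pair turns `H` into its conjugate. -/
theorem IsSymplectic.mul_H_J {S : Mat2 n} (hS : IsSymplectic S) (A H : Mat2 n) :
    A * S * H * J n * (A * S)ᴴ = A * (S * H * S⁻¹ * J n) * Aᴴ := by
  rw [Matrix.mul_assoc _ S⁻¹, hS.inv_mul_J, Matrix.conjTranspose_mul]
  simp only [Matrix.mul_assoc]

theorem mul_J_eq_fromBlocks (G : Mat2 n) : G * J n =
    Matrix.fromBlocks (-G.toBlocks₁₂) G.toBlocks₁₁ (-G.toBlocks₂₂) G.toBlocks₂₁ := by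
  conv_lhs => rw [← Matrix.fromBlocks_toBlocks G, J, Matrix.fromBlocks_multiply]
  simp

/-- The velocity in terms of `M`, with the blocks of `S₂ H S₂⁻¹ = [[A, S], [D, -Aᴴ]]`. The second
block column is the one matched with the flow of `[Q; P]`. -/
theorem T_fst_velocity {S₂ H : Mat2 n} (hS₂ : IsSymplectic S₂) (hH : IsHamiltonian H)
    (S₁ X : Mat2 n) :
    (T S₁ S₂ X).1 * H * J n * ((T S₁ S₂ X).1)ᴴ =
      Matrix.fromBlocks
        (X.toBlocks₁₂ * -(S₂ * H * S₂⁻¹).toBlocks₁₂ * (X.toBlocks₁₂)ᴴ)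
        (X.toBlocks₁₂ * -(S₂ * H * S₂⁻¹).toBlocks₁₂ * (X.toBlocks₂₂)ᴴ +
          X.toBlocks₁₂ * (S₂ * H * S₂⁻¹).toBlocks₁₁)
        ((X.toBlocks₂₂ * -(S₂ * H * S₂⁻¹).toBlocks₁₂ + ((S₂ * H * S₂⁻¹).toBlocks₁₁)ᴴ) *
          (X.toBlocks₁₂)ᴴ)
        ((X.toBlocks₂₂ * -(S₂ * H * S₂⁻¹).toBlocks₁₂ + ((S₂ * H * S₂⁻¹).toBlocks₁₁)ᴴ) *
          (X.toBlocks₂₂)ᴴ +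
          (X.toBlocks₂₂ * (S₂ * H * S₂⁻¹).toBlocks₁₁ + (S₂ * H * S₂⁻¹).toBlocks₂₁)) := by
  refine (hS₂.mul_H_J (Matrix.fromBlocks X.toBlocks₁₂ 0 X.toBlocks₂₂ 1) H).trans ?_
  rw [mul_J_eq_fromBlocks, (hH.conj hS₂).blocks.1, Matrix.fromBlocks_conjTranspose,
    Matrix.fromBlocks_multiply, Matrix.fromBlocks_multiply]
  simp only [Matrix.conjTranspose_zero, Matrix.conjTranspose_one, Matrix.zero_mul, Matrix.mul_zero,
    Matrix.mul_one, Matrix.one_mul, add_zero, neg_neg]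

/-- The velocity in terms of `L`, with the blocks of `S₁ H S₁⁻¹ = [[A⋆, S⋆], [D⋆, -A⋆ᴴ]]`. The
first block column is the one matched with the flow of `[Q⋆; P⋆]`. -/
theorem T_snd_velocity {S₁ H : Mat2 n} (hS₁ : IsSymplectic S₁) (hH : IsHamiltonian H)
    (S₂ X : Mat2 n) :
    (T S₁ S₂ X).2 * H * J n * ((T S₁ S₂ X).2)ᴴ =
      Matrix.fromBlocks
        (-(S₁ * H * S₁⁻¹).toBlocks₁₂ + X.toBlocks₁₁ * ((S₁ * H * S₁⁻¹).toBlocks₁₁)ᴴ +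
          ((S₁ * H * S₁⁻¹).toBlocks₁₁ + X.toBlocks₁₁ * (S₁ * H * S₁⁻¹).toBlocks₂₁) *
            (X.toBlocks₁₁)ᴴ)
        (((S₁ * H * S₁⁻¹).toBlocks₁₁ + X.toBlocks₁₁ * (S₁ * H * S₁⁻¹).toBlocks₂₁) *
          (X.toBlocks₂₁)ᴴ)
        (X.toBlocks₂₁ * ((S₁ * H * S₁⁻¹).toBlocks₁₁)ᴴ +
          X.toBlocks₂₁ * (S₁ * H * S₁⁻¹).toBlocks₂₁ * (X.toBlocks₁₁)ᴴ)
        (X.toBlocks₂₁ * (S₁ * H * S₁⁻¹).toBlocks₂₁ * (X.toBlocks₂₁)ᴴ) := by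
  refine (hS₁.mul_H_J (Matrix.fromBlocks 1 X.toBlocks₁₁ 0 X.toBlocks₂₁) H).trans ?_
  rw [mul_J_eq_fromBlocks, (hH.conj hS₁).blocks.1, Matrix.fromBlocks_conjTranspose,
    Matrix.fromBlocks_multiply, Matrix.fromBlocks_multiply]
  simp only [Matrix.conjTranspose_zero, Matrix.conjTranspose_one, Matrix.zero_mul, Matrix.mul_zero,
    Matrix.mul_one, Matrix.one_mul, zero_add, neg_neg]

theorem hasDerivAt_fromBlocks {A B C D : ℝ → Mat1 n} {A' B' C' D' : Mat1 n} {t : ℝ}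
    (hA : HasDerivAt A A' t) (hB : HasDerivAt B B' t) (hC : HasDerivAt C C' t)
    (hD : HasDerivAt D D' t) :
    HasDerivAt (fun s => Matrix.fromBlocks (A s) (B s) (C s) (D s))
      (Matrix.fromBlocks A' B' C' D') t := by
  rw [hasDerivAt_matrix_iff] at *
  rintro (i | i) (j | j)
  exacts [hA i j, hB i j, hC i j, hD i j]

/-- The quotient rule for `P Q⁻¹`, with the time shift of the extended solution. -/
theorem hasDerivAt_mul_inv {Q P : ℝ → Mat1 n} {Q' P' : Mat1 n} {t : ℝ}
    (hQ : HasDerivAt Q Q' (t - 1)) (hP : HasDerivAt P P' (t - 1)) (hu : IsUnit (Q (t - 1))) :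
    HasDerivAt (fun s => P (s - 1) * (Q (s - 1))⁻¹)
      ((P' - P (t - 1) * (Q (t - 1))⁻¹ * Q') * (Q (t - 1))⁻¹) t := by
  have h := hasDerivAt_matrix_mul hP (hasDerivAt_matrix_inv hQ hu)
  have e : (P' - P (t - 1) * (Q (t - 1))⁻¹ * Q') * (Q (t - 1))⁻¹ =
      P' * (Q (t - 1))⁻¹ + P (t - 1) * -((Q (t - 1))⁻¹ * Q' * (Q (t - 1))⁻¹) := by
    rw [Matrix.sub_mul, sub_eq_add_neg, Matrix.mul_neg]
    simp only [Matrix.mul_assoc]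
  rw [e]
  rw [hasDerivAt_matrix_iff] at h ⊢
  exact fun i j => (h i j).comp_sub_const t 1

/-- The velocity is computed from `L` in the first block column and from `M` in the second, which is
possible since both halves of the pair give the same velocity. -/
theorem extendedSolution_hasDerivAt {S₁ S₂ X₁ : Mat2 n} (hS₁ : IsSymplectic S₁)
    (hS₂ : IsSymplectic S₂) {H : Mat2 n} (hH : IsHamiltonian H) {Q P Qs Ps : ℝ → Mat1 n}
    (hQP : IsLinearFlow (Htilde S₂ H) X₁.toBlocks₂₂ Q P)
    (hQPs : IsLinearFlow (HtildeStar S₁ H) X₁.toBlocks₁₁ Qs Ps) {t : ℝ}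
    (hQ : IsUnit (Q (t - 1))) (hQs : IsUnit (Qs (t - 1)))
    {X : Mat2 n} (hXt : extendedSolution X₁ Q P Qs Ps t = X) (hX : X.IsHermitian)
    (hv : (T S₁ S₂ X).1 * H * J n * ((T S₁ S₂ X).1)ᴴ =
      (T S₁ S₂ X).2 * H * J n * ((T S₁ S₂ X).2)ᴴ) :
    HasDerivAt (extendedSolution X₁ Q P Qs Ps)
      ((T S₁ S₂ X).1 * H * J n * ((T S₁ S₂ X).1)ᴴ) t := by
  have hd := hQP.hasDerivAt (t - 1)
  have hds := hQPs.hasDerivAt (t - 1)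
  have hc : ∀ c : Mat1 n, HasDerivAt (fun _ : ℝ => c) 0 (t - 1) := fun c =>
    hasDerivAt_matrix_iff.2 fun i j => hasDerivAt_const _ (c i j)
  have h11 := hasDerivAt_mul_inv hds.1 hds.2 hQs
  have h12 := hasDerivAt_mul_inv hd.1 (hc X₁.toBlocks₁₂) hQ
  have h21 := hasDerivAt_mul_inv hds.1 (hc X₁.toBlocks₂₁) hQs
  have h22 := hasDerivAt_mul_inv hd.1 hd.2 hQ
  rw [← Matrix.fromBlocks_toBlocks X, Matrix.isHermitian_fromBlocks_iff] at hX
  obtain ⟨x1, x2, x3, x4⟩ := hX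
  have eQ := Matrix.mul_nonsing_inv _ ((Matrix.isUnit_iff_isUnit_det _).1 hQ)
  have eQs := Matrix.mul_nonsing_inv _ ((Matrix.isUnit_iff_isUnit_det _).1 hQs)
  have X11 : Ps (t - 1) * (Qs (t - 1))⁻¹ = X.toBlocks₁₁ := by rw [← hXt]; rfl
  have X12 : X₁.toBlocks₁₂ * (Q (t - 1))⁻¹ = X.toBlocks₁₂ := by rw [← hXt]; rfl
  have X21 : X₁.toBlocks₂₁ * (Qs (t - 1))⁻¹ = X.toBlocks₂₁ := by rw [← hXt]; rfl
  have X22 : P (t - 1) * (Q (t - 1))⁻¹ = X.toBlocks₂₂ := by rw [← hXt]; rfl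
  have hD := hasDerivAt_fromBlocks h11 h12 h21 h22
  have hM := T_fst_velocity hS₂ hH S₁ X
  have hL := T_snd_velocity hS₁ hH S₂ X
  suffices e : (T S₁ S₂ X).1 * H * J n * ((T S₁ S₂ X).1)ᴴ = _ by
    rw [e]
    exact hD
  rw [← Matrix.fromBlocks_toBlocks ((T S₁ S₂ X).1 * H * J n * ((T S₁ S₂ X).1)ᴴ)]
  congr 1
  · rw [hv, hL, Matrix.toBlocks_fromBlocks₁₁, X11, x1.eq]
    simp only [Matrix.sub_mul, Matrix.add_mul, Matrix.mul_add, Matrix.mul_assoc, eQs, X11,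
      Matrix.mul_one, Matrix.neg_mul, Matrix.mul_neg]
    abel
  · rw [hM, Matrix.toBlocks_fromBlocks₁₂, X12, x4.eq]
    simp only [Matrix.add_mul, Matrix.mul_add, Matrix.mul_assoc, eQ, X22,
      Matrix.mul_one, Matrix.neg_mul, Matrix.mul_neg, zero_sub]
    abel
  · rw [hv, hL, Matrix.toBlocks_fromBlocks₂₁, X21, x1.eq]
    simp only [Matrix.add_mul, Matrix.mul_add, Matrix.mul_assoc, eQs, X11,
      Matrix.mul_one, Matrix.neg_mul, Matrix.mul_neg, zero_sub]
    abel
  · rw [hM, Matrix.toBlocks_fromBlocks₂₂, X22, x4.eq]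
    simp only [Matrix.sub_mul, Matrix.add_mul, Matrix.mul_add, Matrix.mul_assoc, eQ, X22,
      Matrix.mul_one, Matrix.neg_mul, Matrix.mul_neg]
    abel

/-! ### The extended solution -/

theorem Tinv_T {S₁ S₂ X : Mat2 n} (hS₁ : IsSymplectic S₁) (hS₂ : IsSymplectic S₂)
    (hX : X.IsHermitian) : Tinv S₁ S₂ (T S₁ S₂ X) = X :=
  (T_injective hS₁ hS₂).injOn.leftInvOn_invFunOn hX

/-- Where `Q(t-1)` is invertible, the two normalizations of the shifted pair are available and, by
uniqueness, give the same Hermitian matrix, which is the extended solution. -/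
theorem extendedSolution_spec {S₁ S₂ X₁ : Mat2 n} (hS₁ : IsSymplectic S₁)
    (hS₂ : IsSymplectic S₂) (hX₁ : X₁.IsHermitian)
    (d : SpectralData (T S₁ S₂ X₁).1 (T S₁ S₂ X₁).2) {Q P Qs Ps : ℝ → Mat1 n}
    (hQP : IsLinearFlow (Htilde S₂ d.H) X₁.toBlocks₂₂ Q P)
    (hQPs : IsLinearFlow (HtildeStar S₁ d.H) X₁.toBlocks₁₁ Qs Ps) {t : ℝ}
    (hQ : IsUnit (Q (t - 1))) :
    IsUnit (Qs (t - 1)) ∧ (extendedSolution X₁ Q P Qs Ps t).IsHermitian ∧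
      (T S₁ S₂ (extendedSolution X₁ Q P Qs Ps t)).1 * d.Pi₀ =
        (T S₁ S₂ (extendedSolution X₁ Q P Qs Ps t)).2 * d.Piinf *
          NormedSpace.exp (t • d.H) := by
  have hb := hX₁
  rw [← Matrix.fromBlocks_toBlocks X₁, Matrix.isHermitian_fromBlocks_iff] at hb
  obtain ⟨y1, y2, y3, y4⟩ := hb
  have hf := flow_Htilde hS₂ d.isHamiltonian_H y4 hQP (t - 1)
  have hfs := flow_HtildeStar hS₁ d.isHamiltonian_H y1 hQPs (t - 1)
  obtain ⟨X, hX, hsys, hX21, hX22⟩ := exists_solution_of_isUnit hS₁ hS₂ hX₁ d hf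
    (hQ.star : IsUnit (Q (t - 1))ᴴ)
  have hQs : IsUnit (Qs (t - 1)) := by
    have := (isUnit_of_solvable_star hS₁ hS₂ d hfs hsys).star
    rwa [Matrix.star_eq_conjTranspose, Matrix.conjTranspose_conjTranspose] at this
  obtain ⟨X', hX', hsys', hX12, hX11⟩ := exists_solution_of_isUnit_star hS₁ hS₂ hX₁ d hfs
    (hQs.star : IsUnit (Qs (t - 1))ᴴ)
  obtain rfl := solution_unique d hS₁ hS₂ hsys hsys'
  have hXb := hX
  rw [← Matrix.fromBlocks_toBlocks X, Matrix.isHermitian_fromBlocks_iff] at hXb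
  obtain ⟨x1, x2, x3, x4⟩ := hXb
  have e : extendedSolution X₁ Q P Qs Ps t = X := by
    -- Each block is the conjugate transpose of a block of `X` read off in one of the two
    -- descriptions, `X₁₂` and `X₂₂` from the first, `X₁₁` and `X₂₁` from the second.
    have e11 := congrArg Matrix.conjTranspose hX11
    have e12 := congrArg Matrix.conjTranspose hX21
    have e21 := congrArg Matrix.conjTranspose hX12
    have e22 := congrArg Matrix.conjTranspose hX22
    rw [x1.eq] at e11
    rw [x3] at e12
    rw [x2] at e21
    rw [x4.eq] at e22
    simp only [Matrix.conjTranspose_mul, Matrix.conjTranspose_nonsing_inv,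
      Matrix.conjTranspose_conjTranspose, y2, y3] at e11 e12 e21 e22
    rw [extendedSolution, ← e11, ← e12, ← e21, ← e22, Matrix.fromBlocks_toBlocks]
  rw [e]
  exact ⟨hQs, hX, hsys⟩

end SymplecticFlow

theorem theorem3p11 (n : ℕ) (S₁ S₂ X₁ : SymplecticFlow.Mat2 n)
    (hS₁ : SymplecticFlow.IsSymplectic S₁) (hS₂ : SymplecticFlow.IsSymplectic S₂)
    (hX₁ : X₁.IsHermitian)
    (hreg : SymplecticFlow.IsRegularPair
      (SymplecticFlow.T S₁ S₂ X₁).1 (SymplecticFlow.T S₁ S₂ X₁).2)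
    (hind : ∃ ν ≤ 1, SymplecticFlow.HasIndexAtInfinity
      (SymplecticFlow.T S₁ S₂ X₁).1 (SymplecticFlow.T S₁ S₂ X₁).2 ν)
    (d : SymplecticFlow.SpectralData
      (SymplecticFlow.T S₁ S₂ X₁).1 (SymplecticFlow.T S₁ S₂ X₁).2)
    (Q P Qs Ps : ℝ → Matrix (Fin n) (Fin n) ℂ)
    (hQP : SymplecticFlow.IsLinearFlow (SymplecticFlow.Htilde S₂ d.H) X₁.toBlocks₂₂ Q P)
    (hQPs : SymplecticFlow.IsLinearFlow (SymplecticFlow.HtildeStar S₁ d.H) X₁.toBlocks₁₁ Qs Ps) :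
    -- the extended solution is well defined on `𝒯_W + 1`
    (∀ t ∈ SymplecticFlow.TWplusOne Q, IsUnit (Qs (t - 1))) ∧
    -- and it solves the initial value problem `X' = M H 𝒥 Mᴴ`, `X(1) = X₁` there
    ((1 : ℝ) ∈ SymplecticFlow.TWplusOne Q ∧
      SymplecticFlow.extendedSolution X₁ Q P Qs Ps 1 = X₁ ∧
      ∀ t ∈ SymplecticFlow.TWplusOne Q,
        HasDerivAt (SymplecticFlow.extendedSolution X₁ Q P Qs Ps)
          ((SymplecticFlow.T S₁ S₂ (SymplecticFlow.extendedSolution X₁ Q P Qs Ps t)).1 *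
            d.H * SymplecticFlow.J n *
            ((SymplecticFlow.T S₁ S₂
              (SymplecticFlow.extendedSolution X₁ Q P Qs Ps t)).1)ᴴ) t) ∧
    (∀ t ∈ SymplecticFlow.TWplusOne Q,
      (SymplecticFlow.extendedSolution X₁ Q P Qs Ps t).IsHermitian ∧
      SymplecticFlow.SolvesLinearSystem S₁ S₂ d.Pi₀ d.Piinf d.H t
        (SymplecticFlow.T S₁ S₂ (SymplecticFlow.extendedSolution X₁ Q P Qs Ps t))) ∧
    SymplecticFlow.TWplusOne Q = SymplecticFlow.TX S₁ S₂ d.Pi₀ d.Piinf d.H ∧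
    (∀ p : ℝ → SymplecticFlow.Mat2 n × SymplecticFlow.Mat2 n,
      (∀ t ∈ SymplecticFlow.TX S₁ S₂ d.Pi₀ d.Piinf d.H,
        SymplecticFlow.SolvesLinearSystem S₁ S₂ d.Pi₀ d.Piinf d.H t (p t)) →
      ∀ t ∈ SymplecticFlow.TX S₁ S₂ d.Pi₀ d.Piinf d.H,
        SymplecticFlow.Tinv S₁ S₂ (p t) = SymplecticFlow.extendedSolution X₁ Q P Qs Ps t ∧
        p t = SymplecticFlow.T S₁ S₂ (SymplecticFlow.extendedSolution X₁ Q P Qs Ps t)) := by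
  have h1 : (1 : ℝ) ∈ SymplecticFlow.TWplusOne Q := by
    simp [SymplecticFlow.TWplusOne, hQP.2.1]
  have hspec := fun t (ht : t ∈ SymplecticFlow.TWplusOne Q) =>
    SymplecticFlow.extendedSolution_spec hS₁ hS₂ hX₁ d hQP hQPs ht
  have hsub : SymplecticFlow.TX S₁ S₂ d.Pi₀ d.Piinf d.H ⊆ SymplecticFlow.TWplusOne Q := by
    rintro t ⟨_, hsys, X, hX, rfl⟩
    have hb := hX₁
    rw [← Matrix.fromBlocks_toBlocks X₁, Matrix.isHermitian_fromBlocks_iff] at hb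
    have hf := SymplecticFlow.flow_Htilde hS₂ d.isHamiltonian_H hb.2.2.2 hQP (t - 1)
    have := (SymplecticFlow.isUnit_of_solvable hS₁ hS₂ d hf hsys).star
    rwa [Matrix.star_eq_conjTranspose, Matrix.conjTranspose_conjTranspose] at this
  refine ⟨fun t ht => (hspec t ht).1, ⟨h1, ?_, fun t ht => ?_⟩, fun t ht => ?_, ?_, ?_⟩
  · simp only [SymplecticFlow.extendedSolution, sub_self, hQP.2.1, hQP.2.2, hQPs.2.1, hQPs.2.2,
      inv_one, Matrix.mul_one, Matrix.fromBlocks_toBlocks]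
  · exact SymplecticFlow.extendedSolution_hasDerivAt hS₁ hS₂ d.isHamiltonian_H hQP hQPs ht
      (hspec t ht).1 rfl (hspec t ht).2.1 (SymplecticFlow.velocity_eq d (hspec t ht).2.2)
  · exact ⟨(hspec t ht).2.1, (hspec t ht).2.2, _, (hspec t ht).2.1, rfl⟩
  · exact Set.Subset.antisymm
      (fun t ht => ⟨_, (hspec t ht).2.2, _, (hspec t ht).2.1, rfl⟩) hsub
  · intro p hp t ht
    obtain ⟨hsys, X, hX, hXp⟩ := hp t ht
    rw [← hXp] at hsys ⊢
    obtain rfl := SymplecticFlow.solution_unique d hS₁ hS₂ hsys (hspec t (hsub ht)).2.2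
    exact ⟨SymplecticFlow.Tinv_T hS₁ hS₂ hX, rfl⟩
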